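/- **Quantum Lifting Theorem (invertible random permutations).** Let $X$ and $Z$ be sets with $X$ finite and nonempty, and let $k,q\ge 0$ be integers. For a permutation $\pi$ of $X$, one quantum query to the invertible permutation oracle is one application of the unitary $$U_\pi\,|b\rangle|x\rangle|y\rangle=\begin{cases}|b\rangle|x\rangle|y+\pi(x)\rangle & b=0,\\ |b\rangle|x\rangle|y+\pi^{-1}(x)\rangle & b=1,\end{cases}$$ where $b\in\{0,1\}$, $x\in X$, and $y$ ranges over a finite abelian group $G$ into which $X$ is embedded by a fixed injection (for instance $G=X=\{0,1\}^n$ with bitwise XOR). A quantum algorithm making $q$ quantum queries alternates arbitrary unitaries on the query registers and a finite-dimensional work register with $q$ applications of $U_\pi$ (tensored with the identity on the work register), starting from a fixed basis state, and obtains its output from a final measurement in the computational basis. A classical query returns $\pi(x)$ or $\pi^{-1}(x)$ for a chosen $x\in X$. Let $\mathcal A$ be a quantum algorithm that makes $q$ quantum queries to the oracle and outputs a tuple $(x_1,\dots,x_k,z)\in X^k\times Z$, and let $R\subseteq X^k\times X^k\times Z$ be any relation. Then there exists a (randomized, computationally unbounded) algorithm $\mathcal B$ making at most $k$ classical queries to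 the oracle, with outputs in $X^k\times Z$, such that $$\Pr_{\pi}\Big[(x_1,\dots,x_k,\pi(x_1),\dots,\pi(x_k),z)\in R:\ (x_1,\dots,x_k,z)\leftarrow\mathcal B^{\pi}\Big]\ \ge\ \frac{1-\frac{k^2}{|X|}}{(8q+1)^{2k}}\ \Pr_{\pi}\Big[(x_1,\dots,x_k,\pi(x_1),\dots,\pi(x_k),z)\in R:\ (x_1,\dots,x_k,z)\leftarrow\mathcal A^{\pi}\Big],$$ where $\pi$ is a uniformly random permutation of $X$ and the probabilities are over $\pi$ and the randomness (including measurements) of the algorithms. -/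

import Mathlib

namespace PermLifting

noncomputable section

/-- The answer of an invertible permutation oracle for `π` to the query `x` in direction `b`:
`π x` for a forward query (`b = false`) and `π⁻¹ x` for a backward query (`b = true`). -/
def answer {X : Type*} (π : Equiv.Perm X) (b : Bool) (x : X) : X :=
  if b then π.symm x else π x

/-! ### Quantum algorithms with an invertible permutation oracle -/

/-- Labels `(b, x, y, w)` of the computational basis: the direction bit, the query register, the
response register and the work register. -/
abbrev QBasis (X G W : Type*) : Type _ := Bool × X × G × W

/-- The state space spanned by the computational basis. -/
abbrev QSpace (X G W : Type*) : Type _ := EuclideanSpace ℂ (QBasis X G W)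

/-- The action of the oracle on basis labels, `(b, x, y, w) ↦ (b, x, y + π^{±1}(x), w)`, where
elements of `X` are written into the response register through the encoding `enc : X ↪ G`. -/
def oracleEquiv {X G : Type*} (W : Type*) [AddCommGroup G] (enc : X ↪ G) (π : Equiv.Perm X) :
    QBasis X G W ≃ QBasis X G W where
  toFun s := (s.1, s.2.1, s.2.2.1 + enc (answer π s.1 s.2.1), s.2.2.2)
  invFun s := (s.1, s.2.1, s.2.2.1 - enc (answer π s.1 s.2.1), s.2.2.2)
  left_inv s := by simp
  right_inv s := by simp

/-- The oracle unitary `U_π`: the linear isometry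
`|b⟩|x⟩|y⟩|w⟩ ↦ |b⟩|x⟩|y + π^{±1}(x)⟩|w⟩`. -/
def oracle {X G : Type*} (W : Type*) [Fintype X] [Fintype G] [Fintype W] [AddCommGroup G]
    (enc : X ↪ G) (π : Equiv.Perm X) : QSpace X G W ≃ₗᵢ[ℂ] QSpace X G W :=
  LinearIsometryEquiv.piLpCongrLeft 2 ℂ ℂ (oracleEquiv W enc π)

theorem oracle_single {X G W : Type*} [Fintype X] [Fintype G] [Fintype W] [AddCommGroup G]
    [DecidableEq X] [DecidableEq G] [DecidableEq W]
    (enc : X ↪ G) (π : Equiv.Perm X) (b : Bool) (x : X) (y : G) (w : W) :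
    oracle W enc π (EuclideanSpace.single (b, x, y, w) 1)
      = EuclideanSpace.single (b, x, y + enc (answer π b x), w) 1 := by
  unfold oracle
  rw [EuclideanSpace.piLpCongrLeft_single]
  rfl

/-- A quantum algorithm with outputs in `Out` that makes `q` queries to an invertible permutation
oracle on `X`, with response register labelled by `G` and (arbitrary finite) work register
labelled by `W`: it starts in a basis state, applies
`unitary q ∘ U_π ∘ unitary (q - 1) ∘ ⋯ ∘ U_π ∘ unitary 0`, measures all registers in the
computational basis and reads its output off the measurement outcome. -/
structure QuantumAlgorithm (X G W Out : Type*) [Fintype X] [Fintype G] [Fintype W] (q : ℕ) where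
  init : QBasis X G W
  unitary : Fin (q + 1) → (QSpace X G W ≃ₗᵢ[ℂ] QSpace X G W)
  out : QBasis X G W → Out

namespace QuantumAlgorithm

variable {X G W Out : Type*} [Fintype X] [DecidableEq X] [Fintype G] [DecidableEq G]
  [AddCommGroup G] [Fintype W] [DecidableEq W] {q : ℕ}

/-- The state after `t` oracle queries and the unitary that follows them. -/
def state (A : QuantumAlgorithm X G W Out q) (enc : X ↪ G) (π : Equiv.Perm X) :
    Fin (q + 1) → QSpace X G W :=
  Fin.induction (A.unitary 0 (EuclideanSpace.single A.init 1))
    (fun t ψ => A.unitary t.succ (oracle W enc π ψ))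

theorem norm_state (A : QuantumAlgorithm X G W Out q) (enc : X ↪ G) (π : Equiv.Perm X)
    (t : Fin (q + 1)) : ‖A.state enc π t‖ = 1 := by
  induction t using Fin.induction with
  | zero => simp [state]
  | succ t ih =>
    have h : A.state enc π t.succ
        = A.unitary t.succ (oracle W enc π (A.state enc π t.castSucc)) := by
      simp [state]
    rw [h, LinearIsometryEquiv.norm_map, LinearIsometryEquiv.norm_map, ih]

/-- The distribution of the outcome of measuring the final state (Born rule). -/
def measurement (A : QuantumAlgorithm X G W Out q) (enc : X ↪ G) (π : Equiv.Perm X) :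
    PMF (QBasis X G W) :=
  PMF.ofFintype (fun s => ENNReal.ofReal (‖A.state enc π (Fin.last q) s‖ ^ 2)) (by
    rw [← ENNReal.ofReal_sum_of_nonneg (fun _ _ => by positivity), ← EuclideanSpace.norm_sq_eq,
      norm_state]
    simp)

/-- The output distribution of the algorithm when its oracle is `π`. -/
def run (A : QuantumAlgorithm X G W Out q) (enc : X ↪ G) (π : Equiv.Perm X) : PMF Out :=
  (A.measurement enc π).map A.out

end QuantumAlgorithm

/-! ### Classical algorithms with an invertible permutation oracle -/

/-- Randomized classical algorithms with outputs in `Out` making at most `k` queries to an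
invertible permutation oracle on `X`: such an algorithm stops with an output, draws a random value
from a distribution of its choice, or makes a forward (`b = false`) or backward (`b = true`) query
at a point and continues depending on the answer. -/
inductive ClassicalAlgorithm (X Out : Type*) : ℕ → Type _
  | output {k : ℕ} (o : Out) : ClassicalAlgorithm X Out k
  | toss {k : ℕ} (p : PMF ℕ) (next : ℕ → ClassicalAlgorithm X Out k) :
      ClassicalAlgorithm X Out k
  | query {k : ℕ} (b : Bool) (x : X) (next : X → ClassicalAlgorithm X Out k) :
      ClassicalAlgorithm X Out (k + 1)

/-- The output distribution of the algorithm when its oracle is `π`. -/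
def ClassicalAlgorithm.run {X Out : Type*} {k : ℕ} (B : ClassicalAlgorithm X Out k)
    (π : Equiv.Perm X) : PMF Out :=
  match B with
  | .output o => PMF.pure o
  | .toss p next => p.bind fun n => (next n).run π
  | .query b x next => (next (answer π b x)).run π

/-! ### Winning probability -/

/-- `winProb R D` is the probability that `(x₁, …, x_k, π(x₁), …, π(x_k), z) ∈ R` when `π` is a
uniformly random permutation of `X` and `(x₁, …, x_k, z)` is drawn from `D π`, the output
distribution with oracle `π`. -/
def winProb {X Z : Type*} [Fintype X] [DecidableEq X] {k : ℕ}
    (R : Set ((Fin k → X) × (Fin k → X) × Z))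
    (D : Equiv.Perm X → PMF ((Fin k → X) × Z)) : ℝ :=
  (((PMF.uniformOfFintype (Equiv.Perm X)).bind fun π =>
    (D π).map fun o => (o.1, (fun i => π (o.1 i)), o.2)).toOuterMeasure R).toReal

end

end PermLifting

namespace PermLifting

noncomputable section

open Finset

/-! ### Probabilities of finite mixtures -/

/-! The classical algorithm samples a uniform permutation σ of its own and runs the quantum
algorithm on σ, patching σ with a few values of π. For the analysis, fix an output tuple x and let D
be its set of points. If σ(D) and π(D) are disjoint, exchanging the σ-values at d and σ⁻¹(π d) for
every d in D gives a permutation ρ that agrees with π on D. Translating σ and π on the left by the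
same permutation translates ρ, so ρ is uniform up to a loss of at most |D|²/|X|
(`mul_sum_le_sum_reprogramPerm`).

The simulator does not know D. However, ρ and σ can differ only at four oracle inputs per point of
D. A query to ρ is therefore a query to the currently patched function plus, for each unpatched
point and each of its four inputs, a difference of two terms supported on that input
(`funOracle_reprogram_eq`). Each of these eight terms per point can be guessed: measure the query,
guess its kind, recover (d, π d) with one classical query, patch, and guess whether the measured
query is answered before or after the patch. Induction on the remaining queries
(`exists_simulation`) gives total branch weight at most (8q+1)^k. This is paid twice, once in
Cauchy–Schwarz and once for sampling the branch, hence the exponent 2k. Summing over x finishes. -/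

/-- The probability of the event `S`, as a real number. -/
def prob {α : Type*} (p : PMF α) (S : Set α) : ℝ := (p.toOuterMeasure S).toReal

theorem prob_nonneg {α : Type*} (p : PMF α) (S : Set α) : 0 ≤ prob p S := ENNReal.toReal_nonneg

theorem toOuterMeasure_ne_top {α : Type*} (p : PMF α) (S : Set α) : p.toOuterMeasure S ≠ ⊤ := by
  rw [PMF.toOuterMeasure_apply]
  refine ne_top_of_le_ne_top ENNReal.one_ne_top ?_
  rw [← p.tsum_coe]
  exact ENNReal.tsum_le_tsum fun a => Set.indicator_le_self _ _ a

theorem prob_bind {α β : Type*} [Fintype α] (p : PMF α) (f : α → PMF β) (S : Set β) :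
    prob (p.bind f) S = ∑ a, (p a).toReal * prob (f a) S := by
  unfold prob
  rw [PMF.toOuterMeasure_bind_apply, tsum_fintype, ENNReal.toReal_sum]
  · simp
  · exact fun a _ => ENNReal.mul_ne_top (p.apply_ne_top a) (toOuterMeasure_ne_top _ _)

theorem prob_eq_sum_fiber {α ι : Type*} [Fintype ι] (p : PMF α) (S : Set α) (g : α → ι) :
    prob p S = ∑ i, prob p {a | a ∈ S ∧ g a = i} := by
  classical
  unfold prob
  rw [← ENNReal.toReal_sum fun i _ => toOuterMeasure_ne_top _ _]
  simp only [PMF.toOuterMeasure_apply]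
  rw [← tsum_fintype (L := .unconditional _), ENNReal.tsum_comm]
  congr 2 with a
  rw [tsum_fintype]
  by_cases ha : a ∈ S <;> simp [Set.indicator_apply, ha]

/-- Nonnegative weights on a finite type are proportional to a probability distribution. -/
theorem exists_pmf_of_weights {α : Type*} [Fintype α] [Nonempty α] (w : α → ℝ)
    (hw : ∀ a, 0 ≤ w a) : ∃ p : PMF α, ∀ a, (p a).toReal * ∑ i, w i = w a := by
  have hs : 0 ≤ ∑ i, w i := sum_nonneg fun i _ => hw i
  rcases hs.eq_or_lt with h0 | h0
  -- If all weights vanish, any distribution satisfies the division-free identity.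
  · refine ⟨PMF.pure (Classical.arbitrary α), fun a => ?_⟩
    rw [← h0, mul_zero, ((sum_eq_zero_iff_of_nonneg fun i _ => hw i).1 h0.symm) a (mem_univ a)]
  · refine ⟨PMF.ofFintype (fun a => ENNReal.ofReal (w a / ∑ i, w i)) ?_, fun a => ?_⟩
    · rw [← ENNReal.ofReal_sum_of_nonneg fun i _ => div_nonneg (hw i) hs, ← sum_div,
        div_self h0.ne', ENNReal.ofReal_one]
    · rw [PMF.ofFintype_apply, ENNReal.toReal_ofReal (div_nonneg (hw a) hs),
        div_mul_cancel₀ _ h0.ne']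

/-- A classical algorithm can choose among finitely many continuations with probabilities
proportional to given weights. -/
theorem ClassicalAlgorithm.exists_toss {X Out α : Type*} {k : ℕ} [Fintype α] [Nonempty α]
    (w : α → ℝ) (hw : ∀ a, 0 ≤ w a) (next : α → ClassicalAlgorithm X Out k) :
    ∃ B : ClassicalAlgorithm X Out k, ∀ π S,
      prob (B.run π) S * ∑ a, w a = ∑ a, w a * prob ((next a).run π) S := by
  classical
  obtain ⟨p, hp⟩ := exists_pmf_of_weights w hw
  let e := Fintype.equivFin α
  -- Tosses draw natural numbers; those beyond the range of `e` have probability zero, so the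
  -- default is harmless.
  let g : ℕ → α := fun n => if h : n < Fintype.card α then e.symm ⟨n, h⟩ else Classical.arbitrary α
  have hg : ∀ a, g (e a : ℕ) = a := fun a => by simp [g]
  refine ⟨.toss (p.map fun a => (e a : ℕ)) fun n => next (g n), fun π S => ?_⟩
  have : (ClassicalAlgorithm.toss (p.map fun a => (e a : ℕ)) fun n => next (g n)).run π
      = p.bind fun a => (next a).run π := by
    rw [ClassicalAlgorithm.run, PMF.bind_map]
    congr 1 with a : 1
    simp [hg]
  rw [this, prob_bind, sum_mul]
  exact sum_congr rfl fun a _ => by rw [← hp a]; ring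

theorem winProb_eq {X Z : Type*} [Fintype X] [DecidableEq X] {k : ℕ}
    (R : Set ((Fin k → X) × (Fin k → X) × Z)) (D : Equiv.Perm X → PMF ((Fin k → X) × Z)) :
    winProb R D = (Fintype.card (Equiv.Perm X) : ℝ)⁻¹ *
      ∑ π, prob (D π) {o | (o.1, (fun i => π (o.1 i)), o.2) ∈ R} := by
  have := prob_bind (PMF.uniformOfFintype (Equiv.Perm X))
    (fun π => (D π).map fun o => (o.1, (fun i => π (o.1 i)), o.2)) R
  rw [winProb, ← prob, this, mul_sum]
  refine sum_congr rfl fun π _ => ?_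
  rw [PMF.uniformOfFintype_apply, ENNReal.toReal_inv, ENNReal.toReal_natCast, prob, prob,
    PMF.toOuterMeasure_map_apply]
  rfl

/-! ### Reprogramming a permutation -/

section Reprogram

variable {X : Type*}

/-- The points at which the answers of `σ` change when `x` is remapped to `y`, listed as a
direction and an input: forward `x` and `σ⁻¹ y`, backward `y` and `σ x`. -/
def changedPoint (σ : Equiv.Perm X) (x y : X) : Bool × Bool → Bool × X
  | (false, false) => (false, x)
  | (false, true) => (false, σ.symm y)
  | (true, false) => (true, y)
  | (true, true) => (true, σ x)

/-- No point of `D` is mapped by `σ` to an image under `π` of a point of `D`. -/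
def Separated (σ π : Equiv.Perm X) (D : Finset X) : Prop :=
  ∀ x ∈ D, ∀ x' ∈ D, σ x ≠ π x'

variable {σ π : Equiv.Perm X} {D T : Finset X}

/-- Any coincidence other than the trivial one would force a σ-value on D to equal a π-value on D.
Hence a basis query touches at most one pair (x, t). -/
theorem changedPoint_injective (h : Separated σ π D) {x x' : X} (hx : x ∈ D) (hx' : x' ∈ D)
    {t t' : Bool × Bool} (e : changedPoint σ x (π x) t = changedPoint σ x' (π x') t') :
    x = x' ∧ t = t' := by
  have h1 := h x hx x' hx'
  have h2 := h x' hx' x hx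
  have h3 : ∀ a b, a = σ.symm b ↔ σ a = b := fun a b => by rw [Equiv.eq_symm_apply]
  have h4 : ∀ a b, σ.symm b = a ↔ σ a = b := fun a b => by rw [eq_comm, h3]
  obtain ⟨_ | _, _ | _⟩ := t <;> obtain ⟨_ | _, _ | _⟩ := t' <;>
    simp_all [changedPoint, eq_comm]

theorem separated_mul_iff (τ : Equiv.Perm X) : Separated (τ * σ) (τ * π) D ↔ Separated σ π D := by
  simp [Separated]

variable [DecidableEq X]

/-- The oracle answers of `σ` after the points of `T` have been remapped according to `π`. -/
def reprogram (σ π : Equiv.Perm X) (T : Finset X) : Bool → X → X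
  | false, u => if u ∈ T then π u else if π.symm (σ u) ∈ T then σ (π.symm (σ u)) else σ u
  | true, v => if π.symm v ∈ T then π.symm v
      else if σ.symm v ∈ T then σ.symm (π (σ.symm v)) else σ.symm v

/-- The answer function `f` after remapping `x` to `y`. -/
def remap (σ : Equiv.Perm X) (f : Bool → X → X) (x y : X) : Bool → X → X
  | false, u => if u = x then y else if u = σ.symm y then σ x else f false u
  | true, v => if v = y then x else if v = σ x then σ.symm y else f true v

instance (σ π : Equiv.Perm X) (D : Finset X) : Decidable (Separated σ π D) := by
  unfold Separated; infer_instance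

theorem reprogram_empty (σ π : Equiv.Perm X) : reprogram σ π ∅ = answer σ := by
  funext b u
  cases b <;> simp [reprogram, answer]

/-- Separation keeps the exchange for x from interfering with those for T, so patches can be made
one point at a time, knowing only x and π x. -/
theorem remap_reprogram (h : Separated σ π D) (hT : T ⊆ D) {x : X} (hx : x ∈ D) :
    remap σ (reprogram σ π T) x (π x) = reprogram σ π (insert x T) := by
  funext b u
  cases b
  · simp only [remap, reprogram, mem_insert]
    by_cases h1 : u = x
    · simp [h1]
    · by_cases h2 : u = σ.symm (π x)
      · have : u ∉ T := fun hu => h u (hT hu) x hx (by simp [h2])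
        subst h2
        simp [h1, this]
      · have : π.symm (σ u) ≠ x := fun e => h2 (by rw [← e]; simp)
        simp [h1, h2, this]
  · simp only [remap, reprogram, mem_insert]
    by_cases h1 : u = π x
    · simp [h1]
    · have h1' : π.symm u ≠ x := fun e => h1 (by rw [← e]; simp)
      by_cases h2 : u = σ x
      · have : π.symm u ∉ T := fun hu => h x hx _ (hT hu) (by simp [h2])
        subst h2
        simp [h1, h1', this]
      · have : σ.symm u ≠ x := fun e => h2 (by rw [← e]; simp)
        simp [h1, h1', h2, this]

/-- The partners σ⁻¹(π x) and π⁻¹(σ x) lie outside D, so patching x alone already settles its four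
inputs. -/
theorem reprogram_changedPoint (h : Separated σ π D) (hT : T ⊆ D) {x : X} (hx : x ∈ T)
    (t : Bool × Bool) :
    reprogram σ π T (changedPoint σ x (π x) t).1 (changedPoint σ x (π x) t).2
      = reprogram σ π D (changedPoint σ x (π x) t).1 (changedPoint σ x (π x) t).2 := by
  have hD := hT hx
  have h1 : σ.symm (π x) ∉ D := fun hu => h _ hu x hD (by simp)
  have h2 : π.symm (σ x) ∉ D := fun hu => h x hD _ hu (by simp)
  have h1' : σ.symm (π x) ∉ T := fun hu => h1 (hT hu)
  have h2' : π.symm (σ x) ∉ T := fun hu => h2 (hT hu)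
  obtain ⟨_ | _, _ | _⟩ := t <;> simp [changedPoint, reprogram, hx, hD, h1, h2, h1', h2']

theorem reprogram_eq_of_forall_ne (hT : T ⊆ D) {b : Bool} {u : X}
    (h : ∀ x ∈ D \ T, ∀ t, changedPoint σ x (π x) t ≠ (b, u)) :
    reprogram σ π T b u = reprogram σ π D b u := by
  have key : ∀ x t, changedPoint σ x (π x) t = (b, u) → (x ∈ T ↔ x ∈ D) := fun x t e =>
    ⟨fun hx => hT hx, fun hx => by_contra fun hn => h x (mem_sdiff.2 ⟨hx, hn⟩) t e⟩
  cases b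
  · have h1 := key u (false, false) rfl
    have h2 := key (π.symm (σ u)) (false, true) (by simp [changedPoint])
    simp only [reprogram, h1, h2]
  · have h1 := key (π.symm u) (true, false) (by simp [changedPoint])
    have h2 := key (σ.symm u) (true, true) (by simp [changedPoint])
    simp only [reprogram, h1, h2]

/-- The permutation obtained from `σ` by remapping the points of `D` according to `π`. -/
def reprogramPerm (σ π : Equiv.Perm X) (D : Finset X) : Equiv.Perm X :=
  if h : Separated σ π D then
    { toFun := reprogram σ π D false
      invFun := reprogram σ π D true
      left_inv := fun u => by
        by_cases h1 : u ∈ D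
        · simp [reprogram, h1]
        · by_cases h2 : π.symm (σ u) ∈ D
          · have h3 : π.symm (σ (π.symm (σ u))) ∉ D := fun hu => h _ h2 _ hu (by simp)
            simp [reprogram, h1, h2, h3]
          · simp [reprogram, h1, h2]
      right_inv := fun v => by
        by_cases h1 : π.symm v ∈ D
        · simp [reprogram, h1]
        · by_cases h2 : σ.symm v ∈ D
          · have h3 : σ.symm (π (σ.symm v)) ∉ D := fun hu => h _ hu _ h2 (by simp)
            simp [reprogram, h1, h2, h3]
          · simp [reprogram, h1, h2] }
  -- Junk value: every use assumes separation.
  else 1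

theorem answer_reprogramPerm (h : Separated σ π D) :
    answer (reprogramPerm σ π D) = reprogram σ π D := by
  funext b u
  cases b <;> simp [answer, reprogramPerm, h, Equiv.symm]

theorem reprogramPerm_apply (h : Separated σ π D) (u : X) :
    reprogramPerm σ π D u = reprogram σ π D false u := by
  simp [reprogramPerm, h]

theorem reprogramPerm_apply_of_mem (h : Separated σ π D) {x : X} (hx : x ∈ D) :
    reprogramPerm σ π D x = π x := by
  rw [reprogramPerm_apply h]
  simp [reprogram, hx]

/-- Left multiplication only relabels values, and the construction only compares values. This
equivariance is the source of uniformity. -/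
theorem reprogramPerm_mul (h : Separated σ π D) (τ : Equiv.Perm X) :
    reprogramPerm (τ * σ) (τ * π) D = τ * reprogramPerm σ π D := by
  ext u
  have hs (v : X) : (τ * π).symm v = π.symm (τ.symm v) := rfl
  rw [reprogramPerm_apply ((separated_mul_iff τ).2 h), Equiv.Perm.mul_apply,
    reprogramPerm_apply h]
  simp only [reprogram, Equiv.Perm.mul_apply, hs, Equiv.symm_apply_apply]
  split_ifs <;> rfl

/-! ### Uniformity of the reprogrammed permutation -/

variable [Fintype X]

/-- Composing with a transposition of values is a bijection between any two fibres of evaluation at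
x. -/
theorem card_filter_apply_eq_mul (x v : X) :
    #{σ : Equiv.Perm X | σ x = v} * Fintype.card X = Fintype.card (Equiv.Perm X) := by
  have h (v' : X) : #{σ : Equiv.Perm X | σ x = v'} = #{σ : Equiv.Perm X | σ x = v} := by
    refine card_equiv (Equiv.mulLeft (Equiv.swap v' v)) fun σ => ?_
    simp only [mem_filter, mem_univ, true_and, Equiv.coe_mulLeft, Equiv.Perm.mul_apply]
    rw [Equiv.swap_apply_eq_iff, Equiv.swap_apply_right]
  have hs := card_eq_sum_card_fiberwise (s := univ) (f := fun σ : Equiv.Perm X => σ x)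
    (t := univ) (by simp)
  rw [← card_univ (α := Equiv.Perm X), hs, sum_congr rfl fun v' _ => h v', sum_const, card_univ,
    smul_eq_mul, mul_comm]

theorem card_not_separated_le (π : Equiv.Perm X) (D : Finset X) :
    #{σ : Equiv.Perm X | ¬ Separated σ π D} * Fintype.card X
      ≤ #D ^ 2 * Fintype.card (Equiv.Perm X) := by
  have hsub : ({σ : Equiv.Perm X | ¬ Separated σ π D} : Finset _)
      ⊆ (D ×ˢ D).biUnion fun a => {σ : Equiv.Perm X | σ a.1 = π a.2} := by
    intro σ hσ
    have hσ := (mem_filter.1 hσ).2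
    simp only [Separated, not_forall, not_not] at hσ
    obtain ⟨x, hx, x', hx', e⟩ := hσ
    simp only [mem_biUnion, mem_product, mem_filter, mem_univ, true_and, Prod.exists]
    exact ⟨x, x', ⟨hx, hx'⟩, e⟩
  calc _ ≤ (∑ a ∈ D ×ˢ D, #{σ : Equiv.Perm X | σ a.1 = π a.2}) * Fintype.card X :=
        Nat.mul_le_mul_right _ ((card_le_card hsub).trans card_biUnion_le)
    _ = _ := by
        rw [sum_mul, sum_congr rfl fun a _ => card_filter_apply_eq_mul a.1 (π a.2), sum_const,
          card_product, smul_eq_mul, sq]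

/-- A random permutation reprogrammed according to another one is uniformly distributed, up to the
probability that the two are not separated. -/
theorem mul_sum_le_sum_reprogramPerm [Nonempty X] (D : Finset X) (F : Equiv.Perm X → ℝ)
    (hF : ∀ ρ, 0 ≤ F ρ) :
    (1 - (#D : ℝ) ^ 2 / Fintype.card X) * Fintype.card (Equiv.Perm X) * ∑ ρ, F ρ
      ≤ ∑ π, ∑ σ, if Separated σ π D then F (reprogramPerm σ π D) else 0 := by
  set n : ℝ := (Fintype.card (Equiv.Perm X) : ℝ)
  set N : ℝ := (Fintype.card X : ℝ)
  have hN : 0 < N := by simp [N, Fintype.card_pos]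
  have hn : 0 < n := by simp [n, Fintype.card_pos]
  set G := ∑ π, ∑ σ, if Separated σ π D then F (reprogramPerm σ π D) else 0
  have hG (τ : Equiv.Perm X) :
      G = ∑ π, ∑ σ, if Separated σ π D then F (τ * reprogramPerm σ π D) else 0 := by
    refine (Equiv.sum_comp (Equiv.mulLeft τ) _).symm.trans (sum_congr rfl fun π _ => ?_)
    refine (Equiv.sum_comp (Equiv.mulLeft τ) _).symm.trans (sum_congr rfl fun σ _ => ?_)
    refine if_ctx_congr (separated_mul_iff τ) (fun h => ?_) fun _ => rfl
    rw [Equiv.coe_mulLeft, reprogramPerm_mul h]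
  have hnG : n * G = ∑ π : Equiv.Perm X, (#{σ : Equiv.Perm X | Separated σ π D} : ℝ) * ∑ ρ, F ρ := by
    -- Averaging over τ: for a fixed separated pair, τ * ρ runs over all permutations exactly once.
    have : n * G = ∑ τ : Equiv.Perm X, G := by simp [n]
    rw [this, sum_congr rfl fun τ _ => hG τ, sum_comm]
    refine sum_congr rfl fun π _ => ?_
    rw [sum_comm, ← nsmul_eq_mul, ← sum_const, sum_filter]
    refine sum_congr rfl fun σ _ => ?_
    split_ifs with h
    · exact Equiv.sum_comp (Equiv.mulRight (reprogramPerm σ π D)) F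
    · exact sum_const_zero
  have hcard (π : Equiv.Perm X) :
      (1 - (#D : ℝ) ^ 2 / N) * n ≤ #{σ : Equiv.Perm X | Separated σ π D} := by
    have h1 : (#{σ : Equiv.Perm X | Separated σ π D} : ℝ) + #{σ : Equiv.Perm X | ¬ Separated σ π D}
        = n := by
      rw [show n = (Fintype.card (Equiv.Perm X) : ℝ) from rfl, ← card_univ,
        ← card_filter_add_card_filter_not (s := univ) fun σ => Separated σ π D, Nat.cast_add]
    have h2 : (#{σ : Equiv.Perm X | ¬ Separated σ π D} : ℝ) * N ≤ (#D : ℝ) ^ 2 * n := by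
      simp only [n, N]
      exact_mod_cast card_not_separated_le π D
    have h3 := (le_div_iff₀ hN).2 h2
    have h4 : (1 - (#D : ℝ) ^ 2 / N) * n = n - (#D : ℝ) ^ 2 * n / N := by ring
    linarith
  have hS : 0 ≤ ∑ ρ, F ρ := sum_nonneg fun ρ _ => hF ρ
  refine le_of_mul_le_mul_left ?_ hn
  rw [hnG]
  calc n * ((1 - (#D : ℝ) ^ 2 / N) * n * ∑ ρ, F ρ)
      = ∑ _π : Equiv.Perm X, (1 - (#D : ℝ) ^ 2 / N) * n * ∑ ρ, F ρ := by simp [n]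
    _ ≤ _ := sum_le_sum fun π _ => mul_le_mul_of_nonneg_right (hcard π) hS

end Reprogram

/-! ### Restricting a state to a set of basis labels -/

/-- The projection of a state to the span of the basis vectors with labels in `s`. -/
def restrict {ι : Type*} (s : Set ι) : EuclideanSpace ℂ ι →ₗ[ℂ] EuclideanSpace ℂ ι where
  toFun ψ := WithLp.toLp 2 (s.indicator ψ)
  map_add' ψ φ := by
    ext i
    by_cases h : i ∈ s <;> simp [h]
  map_smul' c ψ := by
    ext i
    by_cases h : i ∈ s <;> simp [h]

theorem restrict_apply {ι : Type*} (s : Set ι) (ψ : EuclideanSpace ℂ ι) (i : ι) :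
    restrict s ψ i = s.indicator ψ i := rfl

theorem sum_norm_sq_restrict_fiber {ι κ : Type*} [Fintype ι] [Fintype κ] (g : ι → κ)
    (ψ : EuclideanSpace ℂ ι) : ∑ a, ‖restrict {i | g i = a} ψ‖ ^ 2 = ‖ψ‖ ^ 2 := by
  classical
  simp only [EuclideanSpace.norm_sq_eq, restrict_apply]
  rw [sum_comm]
  refine sum_congr rfl fun i _ => ?_
  rw [sum_eq_single (g i)]
  · simp
  · intro a _ ha
    simp [ha.symm]
  · simp

theorem sum_indicator_norm_sq {ι : Type*} [Fintype ι] (s : Set ι) [DecidablePred (· ∈ s)]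
    (ψ : EuclideanSpace ℂ ι) : (∑ i, if i ∈ s then ‖ψ i‖ ^ 2 else 0) = ‖restrict s ψ‖ ^ 2 := by
  rw [EuclideanSpace.norm_sq_eq]
  refine sum_congr rfl fun i _ => ?_
  by_cases h : i ∈ s <;> simp [restrict_apply, h]

/-! ### Oracles answering according to an arbitrary function -/

section Oracle

variable {X G W : Type*} [Fintype X] [Fintype G] [AddCommGroup G] [Fintype W]

/-- The action on basis labels of the oracle with answer function `f`. -/
def funOracleEquiv (W : Type*) (enc : X ↪ G) (f : Bool → X → X) :
    QBasis X G W ≃ QBasis X G W where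
  toFun s := (s.1, s.2.1, s.2.2.1 + enc (f s.1 s.2.1), s.2.2.2)
  invFun s := (s.1, s.2.1, s.2.2.1 - enc (f s.1 s.2.1), s.2.2.2)
  left_inv s := by simp
  right_inv s := by simp

/-- The oracle unitary with answer function `f`. -/
def funOracle (W : Type*) [Fintype W] (enc : X ↪ G) (f : Bool → X → X) :
    QSpace X G W ≃ₗᵢ[ℂ] QSpace X G W :=
  LinearIsometryEquiv.piLpCongrLeft 2 ℂ ℂ (funOracleEquiv W enc f)

theorem funOracle_answer (enc : X ↪ G) (π : Equiv.Perm X) :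
    funOracle W enc (answer π) = oracle W enc π := rfl

theorem funOracle_apply (enc : X ↪ G) (f : Bool → X → X) (ψ : QSpace X G W) (s : QBasis X G W) :
    funOracle W enc f ψ s = ψ (s.1, s.2.1, s.2.2.1 - enc (f s.1 s.2.1), s.2.2.2) := rfl

/-- The projection to the states in which the query is `(b, u) = p`. -/
abbrev restrictQuery (p : Bool × X) : QSpace X G W →ₗ[ℂ] QSpace X G W :=
  restrict {s : QBasis X G W | (s.1, s.2.1) = p}

/-- Runs the remaining part of a quantum algorithm, in which each of the listed unitaries follows
a query to the oracle with answer function `f`. -/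
def runList (enc : X ↪ G) (f : Bool → X → X) (l : List (QSpace X G W ≃ₗᵢ[ℂ] QSpace X G W)) :
    QSpace X G W →ₗ[ℂ] QSpace X G W :=
  match l with
  | [] => LinearMap.id
  | V :: l => runList enc f l ∘ₗ V.toLinearEquiv.toLinearMap ∘ₗ
      (funOracle W enc f).toLinearEquiv.toLinearMap

theorem runList_nil (enc : X ↪ G) (f : Bool → X → X) (ψ : QSpace X G W) :
    runList enc f [] ψ = ψ := rfl

theorem runList_cons (enc : X ↪ G) (f : Bool → X → X) (V : QSpace X G W ≃ₗᵢ[ℂ] QSpace X G W)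
    (l : List (QSpace X G W ≃ₗᵢ[ℂ] QSpace X G W)) (ψ : QSpace X G W) :
    runList enc f (V :: l) ψ = runList enc f l (V (funOracle W enc f ψ)) := rfl

theorem runList_concat (enc : X ↪ G) (f : Bool → X → X) (V : QSpace X G W ≃ₗᵢ[ℂ] QSpace X G W)
    (l : List (QSpace X G W ≃ₗᵢ[ℂ] QSpace X G W)) (ψ : QSpace X G W) :
    runList enc f (l ++ [V]) ψ = V (funOracle W enc f (runList enc f l ψ)) := by
  induction l generalizing ψ with
  | nil => rfl
  | cons U l ih => rw [List.cons_append, runList_cons, ih, runList_cons]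

/-- Converts the recursion on the last query into one on the first, as the simulation peels off
queries from the front. -/
theorem state_eq_runList [DecidableEq X] [DecidableEq G] [DecidableEq W] {Out : Type*} {q : ℕ}
    (A : QuantumAlgorithm X G W Out q) (enc : X ↪ G) (π : Equiv.Perm X) (t : Fin (q + 1)) :
    A.state enc π t
      = runList enc (answer π) ((List.ofFn fun i : Fin q => A.unitary i.succ).take t)
          (A.unitary 0 (EuclideanSpace.single A.init 1)) := by
  induction t using Fin.induction with
  | zero => simp [QuantumAlgorithm.state, runList_nil]
  | succ t ih =>
    have h : A.state enc π t.succ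
        = A.unitary t.succ (oracle W enc π (A.state enc π t.castSucc)) := by
      simp [QuantumAlgorithm.state]
    rw [h, ih, Fin.val_succ, Fin.val_castSucc,
      ← List.take_concat_get' _ (t : ℕ) (by simp), runList_concat, funOracle_answer]
    simp

/-- A query to the fully reprogrammed oracle, split according to which new point, if any, it
touches. -/
theorem funOracle_reprogram_eq [DecidableEq X] (enc : X ↪ G) {σ π : Equiv.Perm X} {D T : Finset X}
    (h : Separated σ π D) (hT : T ⊆ D) (ψ : QSpace X G W) :
    funOracle W enc (reprogram σ π D) ψ = funOracle W enc (reprogram σ π T) ψ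
      + ∑ a ∈ (D \ T) ×ˢ (univ : Finset (Bool × Bool)),
        (funOracle W enc (reprogram σ π (insert a.1 T))
            (restrictQuery (changedPoint σ a.1 (π a.1) a.2) ψ)
          - funOracle W enc (reprogram σ π T)
            (restrictQuery (changedPoint σ a.1 (π a.1) a.2) ψ)) := by
  ext ⟨b, u, y, w⟩
  simp only [PiLp.add_apply, WithLp.ofLp_sum, Finset.sum_apply, PiLp.sub_apply, funOracle_apply,
    restrict_apply, Set.indicator_apply, Set.mem_ofPred_eq]
  by_cases hp : ∃ x ∈ D \ T, ∃ t, changedPoint σ x (π x) t = (b, u)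
  · obtain ⟨x, hx, t, e⟩ := hp
    have hxD := (mem_sdiff.1 hx).1
    rw [sum_eq_single (x, t)]
    · have := reprogram_changedPoint h (insert_subset hxD hT) (mem_insert_self x T) t
      rw [e] at this
      simp [e, this]
    · rintro ⟨x', t'⟩ ha hne
      have : (b, u) ≠ changedPoint σ x' (π x') t' := fun e' => by
        obtain ⟨rfl, rfl⟩ :=
          changedPoint_injective h hxD (mem_sdiff.1 (mem_product.1 ha).1).1 (e.trans e')
        exact hne rfl
      simp [this]
    · exact fun hn => absurd (mem_product.2 ⟨hx, mem_univ _⟩) hn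
  · push Not at hp
    rw [reprogram_eq_of_forall_ne hT hp, sum_eq_zero, add_zero]
    rintro ⟨x, t⟩ ha
    simp [(hp x (mem_product.1 ha).1 t).symm]

end Oracle

/-! ### Simulating a quantum algorithm with few classical queries -/

section Simulation

variable {X : Type*}

/-- The classical query that identifies the remapped point, given that the query input `u` is a
changed point of kind `t`. -/
def learnQuery (σ : Equiv.Perm X) (t : Bool × Bool) (u : X) : Bool × X :=
  match t with
  | (false, false) => (false, u)
  | (false, true) => (true, σ u)
  | (true, false) => (true, u)
  | (true, true) => (false, σ.symm u)

/-- The remapped point and its new image, given the answer `a` to the query `c`. -/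
def learnPair (c : Bool × X) (a : X) : X × X := if c.1 then (a, c.2) else (c.2, a)

theorem learnPair_changedPoint (σ π : Equiv.Perm X) (x : X) (t : Bool × Bool) :
    learnPair (learnQuery σ t (changedPoint σ x (π x) t).2)
      (answer π (learnQuery σ t (changedPoint σ x (π x) t).2).1
        (learnQuery σ t (changedPoint σ x (π x) t).2).2) = (x, π x) := by
  obtain ⟨_ | _, _ | _⟩ := t <;> simp [learnPair, learnQuery, changedPoint, answer]

/-- Cauchy–Schwarz in Sedrakyan's form, with weight w₀ on one term and w₁ on the others. -/
theorem sq_add_sum_le {ι : Type*} (I : Finset ι) (v₀ w₀ w₁ n : ℝ) (v : ι → ℝ) (hw₀ : 0 < w₀)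
    (hw₁ : 0 < w₁) (hn : (#I : ℝ) ≤ n) :
    (v₀ + ∑ i ∈ I, v i) ^ 2 ≤ (w₀ + n * w₁) * (v₀ ^ 2 / w₀ + ∑ i ∈ I, v i ^ 2 / w₁) := by
  have h := sq_sum_div_le_sum_sq_div (insertNone I) (fun i => i.elim v₀ v)
    (g := fun i => i.elim w₀ fun _ => w₁) (by rintro (_ | i) _ <;> assumption)
  simp only [sum_insertNone, Option.elim_none, Option.elim_some, sum_const, nsmul_eq_mul] at h
  rw [div_le_iff₀ (by positivity), mul_comm] at h
  refine h.trans (mul_le_mul_of_nonneg_right ?_ ?_)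
  · gcongr
  · exact add_nonneg (by positivity) (sum_nonneg fun i _ => by positivity)

variable {G W Out : Type*} [Fintype X] [Fintype G] [Fintype W]

theorem exists_simulation_nil [Nonempty (QBasis X G W)] (out : QBasis X G W → Out) (m : ℕ)
    (ψ : QSpace X G W) :
    ∃ B : ClassicalAlgorithm X Out m, ∀ π S,
      ‖restrict (out ⁻¹' S) ψ‖ ^ 2 = prob (B.run π) S * ‖ψ‖ ^ 2 := by
  classical
  obtain ⟨B, hB⟩ := ClassicalAlgorithm.exists_toss (fun s => ‖ψ s‖ ^ 2) (fun s => by positivity)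
    fun s => (.output (out s) : ClassicalAlgorithm X Out m)
  refine ⟨B, fun π S => ?_⟩
  rw [EuclideanSpace.norm_sq_eq ψ, hB, ← sum_indicator_norm_sq]
  refine sum_congr rfl fun s _ => ?_
  rw [ClassicalAlgorithm.run, prob, PMF.toOuterMeasure_pure_apply]
  by_cases h : out s ∈ S <;> simp [h]

/-- Measuring the query of `ψ` and continuing with an algorithm depending on the outcome. -/
theorem exists_measureQuery [Nonempty X] {m : ℕ} (ψ : QSpace X G W)
    (next : Bool × X → ClassicalAlgorithm X Out m) :
    ∃ B : ClassicalAlgorithm X Out m, ∀ π S,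
      prob (B.run π) S * ‖ψ‖ ^ 2
        = ∑ p, ‖restrictQuery p ψ‖ ^ 2 * prob ((next p).run π) S := by
  obtain ⟨B, hB⟩ := ClassicalAlgorithm.exists_toss (fun p => ‖restrictQuery p ψ‖ ^ 2)
    (fun s => by positivity) next
  refine ⟨B, fun π S => ?_⟩
  rw [← hB, sum_norm_sq_restrict_fiber (fun s : QBasis X G W => (s.1, s.2.1)) ψ]

/-- The rest of a run of a quantum algorithm with oracle reprogrammed at an unknown set `D` can be
simulated by a classical algorithm that knows the part `T` of `D` and makes one query for each
point of `D \ T`. -/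
theorem exists_simulation [DecidableEq X] [AddCommGroup G] [Nonempty (QBasis X G W)] (enc : X ↪ G)
    (σ : Equiv.Perm X) (out : QBasis X G W → Out) (l : List (QSpace X G W ≃ₗᵢ[ℂ] QSpace X G W))
    (m : ℕ) (f : Bool → X → X) (ψ : QSpace X G W) :
    ∃ B : ClassicalAlgorithm X Out m, ∀ (π : Equiv.Perm X) (D T : Finset X) (S : Set Out),
      Separated σ π D → T ⊆ D → #(D \ T) ≤ m → f = reprogram σ π T →
      ‖restrict (out ⁻¹' S) (runList enc (reprogram σ π D) l ψ)‖ ^ 2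
        ≤ prob (B.run π) S * ‖ψ‖ ^ 2 * ((8 * (l.length : ℝ) + 1) ^ m) ^ 2 := by
  have : Nonempty X := Nonempty.map (fun s : QBasis X G W => s.2.1) inferInstance
  -- The function f is arbitrary because a wrong guess need not yield a permutation, and ψ is
  -- unnormalized because branches are projected states.
  induction l generalizing m f ψ with
  | nil =>
    obtain ⟨B, hB⟩ := exists_simulation_nil out m ψ
    exact ⟨B, fun π D T S _ _ _ _ => by simp [runList_nil, hB π S]⟩
  | cons V l ih =>
    obtain _ | m := m
    · obtain ⟨B, hB⟩ := ih 0 f (V (funOracle W enc f ψ))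
      refine ⟨B, fun π D T S h hT hm hf => ?_⟩
      have hDT : D = T :=
        (sdiff_eq_empty_iff_subset.1 (card_eq_zero.1 (Nat.le_zero.1 hm))).antisymm hT
      have := hB π D T S h hT hm hf
      rw [LinearIsometryEquiv.norm_map, LinearIsometryEquiv.norm_map] at this
      subst hDT hf
      simpa [runList_cons] using this
    · obtain ⟨B₀, hB₀⟩ := ih (m + 1) f (V (funOracle W enc f ψ))
      let c (t : Bool × Bool) (p : Bool × X) := learnQuery σ t p.2
      let f' (t : Bool × Bool) (p : Bool × X) (a : X) :=
        remap σ f (learnPair (c t p) a).1 (learnPair (c t p) a).2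
      -- The bit β guesses whether the measured query is answered with the patched or the old
      -- function.
      choose B₁ hB₁ using fun (t : Bool × Bool) (β : Bool) (p : Bool × X) (a : X) =>
        ih m (f' t p a) (V (funOracle W enc (if β then f' t p a else f) (restrictQuery p ψ)))
      choose B₂ hB₂ using fun (j : (Bool × Bool) × Bool) => exists_measureQuery ψ fun p =>
        .query (c j.1 p).1 (c j.1 p).2 (B₁ j.1 j.2 p)
      -- These are the costs, by induction, of the remaining run with m + 1 and with m classical
      -- queries left.
      set w₀ : ℝ := (8 * (l.length : ℝ) + 1) ^ (m + 1) with hw₀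
      set w₁ : ℝ := (8 * (l.length : ℝ) + 1) ^ m with hw₁
      have hw₀' : 0 < w₀ := by positivity
      have hw₁' : 0 < w₁ := by positivity
      obtain ⟨B, hB⟩ := ClassicalAlgorithm.exists_toss (fun j => Option.elim j w₀
        fun _ => (m + 1 : ℝ) * w₁) (by rintro (_ | j) <;> simp <;> positivity)
        (fun j => Option.elim j B₀ B₂)
      refine ⟨B, fun π D T S h hT hm hf => ?_⟩
      have hB := hB π S
      simp only [Fintype.sum_option, Option.elim_none, Option.elim_some, sum_const, card_univ,
        Fintype.card_prod, Fintype.card_bool, nsmul_eq_mul, ← mul_sum] at hB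
      -- A seminorm: the size of the accepted part after the remaining run on the full oracle.
      set fin : QSpace X G W → ℝ := fun φ =>
        ‖restrict (out ⁻¹' S) (runList enc (reprogram σ π D) l (V φ))‖ with hfin
      have fin_add (φ φ') : fin (φ + φ') ≤ fin φ + fin φ' := by
        simp only [hfin, map_add]
        exact norm_add_le _ _
      have fin_sub (φ φ') : fin (φ - φ') ≤ fin φ + fin φ' := by
        simp only [hfin, map_sub]
        exact norm_sub_le _ _
      let pt (a : X × Bool × Bool) := changedPoint σ a.1 (π a.1) a.2
      let φ (i : X × (Bool × Bool) × Bool) : QSpace X G W :=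
        funOracle W enc (if i.2.2 then reprogram σ π (insert i.1 T) else f)
          (restrictQuery (pt (i.1, i.2.1)) ψ)
      let I := (D \ T) ×ˢ (univ : Finset ((Bool × Bool) × Bool))
      have hsplit : fin (funOracle W enc (reprogram σ π D) ψ)
          ≤ fin (funOracle W enc f ψ) + ∑ i ∈ I, fin (φ i) := by
        rw [funOracle_reprogram_eq enc h hT, ← hf]
        refine (fin_add _ _).trans (add_le_add le_rfl ?_)
        have hsum (s : Finset (X × Bool × Bool)) (g : X × Bool × Bool → QSpace X G W) :
            fin (∑ a ∈ s, g a) ≤ ∑ a ∈ s, fin (g a) := by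
          simp only [hfin, map_sum]
          exact norm_sum_le _ _
        refine (hsum _ _).trans ?_
        rw [sum_product, sum_product]
        refine sum_le_sum fun x _ => ?_
        refine le_of_le_of_eq ?_ (Fintype.sum_prod_type _).symm
        refine sum_le_sum fun t _ => ?_
        rw [Fintype.sum_bool]
        exact fin_sub _ _
      have hI : (#I : ℝ) ≤ 8 * (m + 1) := by
        have : #I = #(D \ T) * 8 := by simp [I, card_product]
        rw [this, mul_comm]
        push_cast
        gcongr
        exact_mod_cast hm
      have hnone : fin (funOracle W enc f ψ) ^ 2 / w₀ ≤ w₀ * prob (B₀.run π) S * ‖ψ‖ ^ 2 := by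
        have := hB₀ π D T S h hT hm hf
        rw [LinearIsometryEquiv.norm_map, LinearIsometryEquiv.norm_map] at this
        rw [div_le_iff₀ hw₀']
        calc _ ≤ _ := this
          _ = _ := by ring
      have hsome (i) (hi : i ∈ I) : fin (φ i) ^ 2 / w₁ ≤ w₁ *
          (‖restrictQuery (pt (i.1, i.2.1)) ψ‖ ^ 2 * prob ((ClassicalAlgorithm.query
            (c i.2.1 (pt (i.1, i.2.1))).1 (c i.2.1 (pt (i.1, i.2.1))).2
              (B₁ i.2.1 i.2.2 (pt (i.1, i.2.1)))).run π) S) := by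
        obtain ⟨x, t, β⟩ := i
        have hx := (mem_product.1 hi).1
        obtain ⟨hxD, hxT⟩ := mem_sdiff.1 hx
        have hf' : f' t (pt (x, t)) (answer π (c t (pt (x, t))).1 (c t (pt (x, t))).2)
            = reprogram σ π (insert x T) := by
          simp only [f', c, pt, learnPair_changedPoint, hf]
          exact remap_reprogram h hT hxD
        have hcard : #(D \ insert x T) ≤ m := by
          rw [sdiff_insert, card_erase_of_mem hx]
          omega
        have := hB₁ t β (pt (x, t)) (answer π (c t (pt (x, t))).1 (c t (pt (x, t))).2) π D
          (insert x T) S h (insert_subset hxD hT) hcard hf'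
        rw [LinearIsometryEquiv.norm_map, LinearIsometryEquiv.norm_map, hf'] at this
        rw [div_le_iff₀ hw₁', ClassicalAlgorithm.run]
        calc _ ≤ _ := this
          _ = _ := by ring
      have hmeasure : ∑ i ∈ I, fin (φ i) ^ 2 / w₁
          ≤ (m + 1) * w₁ * (∑ j, prob ((B₂ j).run π) S) * ‖ψ‖ ^ 2 := by
        refine (sum_le_sum hsome).trans ?_
        rw [← mul_sum, sum_product_right, mul_assoc, mul_comm (_ + 1 : ℝ), mul_assoc]
        refine mul_le_mul_of_nonneg_left ?_ hw₁'.le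
        have hnn : 0 ≤ (∑ j, prob ((B₂ j).run π) S) * ‖ψ‖ ^ 2 :=
          mul_nonneg (sum_nonneg fun j _ => prob_nonneg _ _) (by positivity)
        -- The measurement selects the point x by itself, so the factor m + 1 is slack; it only
        -- makes the toss weights total w.
        refine le_trans ?_ (le_mul_of_one_le_left hnn (by simp))
        rw [sum_mul]
        refine sum_le_sum fun j _ => ?_
        rw [hB₂]
        -- Distinct points give distinct measurement outcomes, so the sum is part of the sum over
        -- all outcomes.
        rw [← sum_image (s := D \ T) (g := fun x => pt (x, j.1)) (f := fun p =>
          ‖restrictQuery p ψ‖ ^ 2 * prob ((ClassicalAlgorithm.query (c j.1 p).1 (c j.1 p).2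
            (B₁ j.1 j.2 p)).run π) S)]
        · exact sum_le_sum_of_subset_of_nonneg (subset_univ _) fun p _ _ =>
            mul_nonneg (by positivity) (prob_nonneg _ _)
        · exact fun x hx x' hx' e => (changedPoint_injective h
            (mem_sdiff.1 hx).1 (mem_sdiff.1 hx').1 e).1
      have hfin_nonneg (φ) : 0 ≤ fin φ := norm_nonneg _
      set w : ℝ := w₀ + 8 * (m + 1) * w₁ with hw
      have hle : w ≤ (8 * ((V :: l).length : ℝ) + 1) ^ (m + 1) := by
        -- Bernoulli: aⁿ + n aⁿ⁻¹ b ≤ (a + b)ⁿ with b = 8 and n = m + 1.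
        have := pow_add_mul_le_add_pow (a := 8 * (l.length : ℝ) + 1) (b := 8) (by positivity)
          (by positivity) (m + 1)
        rw [List.length_cons]
        push_cast at this ⊢
        calc w = _ := by rw [hw, hw₀, hw₁]; ring
          _ ≤ _ := this
          _ = _ := by ring_nf
      have hw' : 0 ≤ w := by positivity
      have hB' : w * prob (B.run π) S
          = w₀ * prob (B₀.run π) S + (m + 1) * w₁ * ∑ j, prob ((B₂ j).run π) S := by
        rw [← hB, hw]
        push_cast
        ring
      rw [runList_cons]
      calc _ ≤ (fin (funOracle W enc f ψ) + ∑ i ∈ I, fin (φ i)) ^ 2 :=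
            pow_le_pow_left₀ (hfin_nonneg _) hsplit 2
        _ ≤ w * (fin (funOracle W enc f ψ) ^ 2 / w₀ + ∑ i ∈ I, fin (φ i) ^ 2 / w₁) :=
            sq_add_sum_le I _ _ _ _ _ hw₀' hw₁' hI
        _ ≤ w * (w₀ * prob (B₀.run π) S * ‖ψ‖ ^ 2
              + (m + 1) * w₁ * (∑ j, prob ((B₂ j).run π) S) * ‖ψ‖ ^ 2) :=
            mul_le_mul_of_nonneg_left (add_le_add hnone hmeasure) hw'
        -- The second factor w is the normalization of the toss.
        _ = prob (B.run π) S * ‖ψ‖ ^ 2 * w ^ 2 := by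
            rw [← add_mul, ← hB']
            ring
        _ ≤ _ := mul_le_mul_of_nonneg_left (pow_le_pow_left₀ hw' hle 2)
            (mul_nonneg (prob_nonneg _ _) (by positivity))

end Simulation

/-! ### Born rule for events and the final averaging -/

theorem prob_run_eq {X G W Out : Type*} [Fintype X] [DecidableEq X] [Fintype G] [DecidableEq G]
    [AddCommGroup G] [Fintype W] [DecidableEq W] {q : ℕ} (A : QuantumAlgorithm X G W Out q)
    (enc : X ↪ G) (π : Equiv.Perm X) (S : Set Out) :
    prob (A.run enc π) S = ‖restrict (A.out ⁻¹' S) (A.state enc π (Fin.last q))‖ ^ 2 := by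
  classical
  rw [prob, QuantumAlgorithm.run, PMF.toOuterMeasure_map_apply, PMF.toOuterMeasure_apply_fintype,
    ENNReal.toReal_sum, ← sum_indicator_norm_sq]
  · refine sum_congr rfl fun s _ => ?_
    by_cases h : s ∈ A.out ⁻¹' S
    · rw [Set.indicator_of_mem h, if_pos h, QuantumAlgorithm.measurement, PMF.ofFintype_apply,
        ENNReal.toReal_ofReal (by positivity)]
    · rw [Set.indicator_of_notMem h, if_neg h, ENNReal.toReal_zero]
  · intro s _
    exact ne_top_of_le_ne_top (PMF.apply_ne_top _ s) (Set.indicator_le_self _ _ s)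

end

end PermLifting

open PermLifting Finset in
theorem mainTheorem1 {X G W Z : Type*} [Fintype X] [DecidableEq X]
    [Fintype G] [DecidableEq G] [AddCommGroup G] (enc : X ↪ G) [Fintype W] [DecidableEq W]
    (k q : ℕ) (A : PermLifting.QuantumAlgorithm X G W ((Fin k → X) × Z) q)
    (R : Set ((Fin k → X) × (Fin k → X) × Z)) :
    ∃ B : PermLifting.ClassicalAlgorithm X ((Fin k → X) × Z) k,
      PermLifting.winProb R (fun π => B.run π) ≥
        (1 - (k : ℝ) ^ 2 / (Fintype.card X : ℝ)) / (8 * (q : ℝ) + 1) ^ (2 * k) *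
          PermLifting.winProb R (fun π => A.run enc π) := by
  have : Nonempty (QBasis X G W) := ⟨A.init⟩
  have : Nonempty X := ⟨A.init.2.1⟩
  choose Bσ hBσ using fun σ : Equiv.Perm X => exists_simulation enc σ A.out
    (List.ofFn fun i : Fin q => A.unitary i.succ) k (answer σ)
    (A.unitary 0 (EuclideanSpace.single A.init 1))
  obtain ⟨B, hB⟩ := ClassicalAlgorithm.exists_toss (fun _ : Equiv.Perm X => (1 : ℝ))
    (fun _ => zero_le_one) Bσ
  refine ⟨B, ?_⟩
  set M : ℝ := (8 * (q : ℝ) + 1) ^ (2 * k) with hM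
  set N : ℝ := (Fintype.card X : ℝ)
  set n : ℝ := (Fintype.card (Equiv.Perm X) : ℝ)
  have hM' : 0 < M := by positivity
  have hn : 0 < n := by simp [n, Fintype.card_pos]
  let E (π : Equiv.Perm X) (x : Fin k → X) : Set ((Fin k → X) × Z) :=
    {o | o ∈ {o : (Fin k → X) × Z | (o.1, (fun i => π (o.1 i)), o.2) ∈ R} ∧ o.1 = x}
  have hrun (π : Equiv.Perm X) (x : Fin k → X) : prob (A.run enc π) (E π x)
      = ‖restrict (A.out ⁻¹' E π x) (runList enc (answer π)
          (List.ofFn fun i : Fin q => A.unitary i.succ)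
          (A.unitary 0 (EuclideanSpace.single A.init 1)))‖ ^ 2 := by
    rw [prob_run_eq, state_eq_runList, List.take_of_length_le (by simp)]
  have hsim (x : Fin k → X) (σ π : Equiv.Perm X) (h : Separated σ π (univ.image x)) :
      prob (A.run enc (reprogramPerm σ π (univ.image x))) (E (reprogramPerm σ π (univ.image x)) x)
        ≤ prob ((Bσ σ).run π) (E π x) * M := by
    -- Success with output tuple x depends on the permutation only through its values on D, where ρ
    -- and π agree.
    have hE : E (reprogramPerm σ π (univ.image x)) x = E π x := by
      ext o
      simp only [E, Set.mem_ofPred_eq, and_congr_left_iff]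
      rintro rfl
      simp only [reprogramPerm_apply_of_mem h (mem_image_of_mem _ (mem_univ _))]
    have hcard : #(univ.image x \ ∅) ≤ k := by
      simpa using card_image_le (s := univ) (f := x)
    rw [hrun, hE, answer_reprogramPerm h]
    refine (hBσ σ π _ ∅ (E π x) h (empty_subset _) hcard (reprogram_empty σ π).symm).trans_eq ?_
    rw [LinearIsometryEquiv.norm_map, List.length_ofFn, hM, ← pow_mul, mul_comm k 2]
    simp
  -- The same B serves every x, so these bounds can be summed over the output tuple.
  have hfix (x : Fin k → X) : (1 - (k : ℝ) ^ 2 / N) * ∑ π, prob (A.run enc π) (E π x)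
      ≤ M * ∑ π, prob (B.run π) (E π x) := by
    have hd : (#(univ.image x) : ℝ) ≤ k := by
      exact_mod_cast (card_image_le (s := univ) (f := x)).trans_eq (by simp)
    have hS : 0 ≤ ∑ π, prob (A.run enc π) (E π x) := sum_nonneg fun π _ => prob_nonneg _ _
    refine le_of_mul_le_mul_left ?_ hn
    calc n * ((1 - (k : ℝ) ^ 2 / N) * ∑ π, prob (A.run enc π) (E π x))
        = (1 - (k : ℝ) ^ 2 / N) * n * ∑ π, prob (A.run enc π) (E π x) := by ring
      _ ≤ (1 - (#(univ.image x) : ℝ) ^ 2 / N) * n * ∑ π, prob (A.run enc π) (E π x) := by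
          gcongr
      _ ≤ _ := mul_sum_le_sum_reprogramPerm (univ.image x) (fun ρ => prob (A.run enc ρ) (E ρ x))
          fun ρ => prob_nonneg _ _
      _ ≤ ∑ π, ∑ σ, prob ((Bσ σ).run π) (E π x) * M := by
          refine sum_le_sum fun π _ => sum_le_sum fun σ _ => ?_
          split_ifs with h
          · exact hsim x σ π h
          · exact mul_nonneg (prob_nonneg _ _) hM'.le
      _ = n * (M * ∑ π, prob (B.run π) (E π x)) := by
          rw [mul_sum, mul_sum]
          refine sum_congr rfl fun π _ => ?_
          have := hB π (E π x)
          simp only [sum_const, card_univ, nsmul_eq_mul, mul_one, one_mul] at this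
          rw [← sum_mul, ← this]
          ring
  rw [ge_iff_le, winProb_eq, winProb_eq, div_mul_eq_mul_div, div_le_iff₀ hM']
  have hE (P : Equiv.Perm X → PMF ((Fin k → X) × Z)) :
      ∑ π, prob (P π) {o | (o.1, (fun i => π (o.1 i)), o.2) ∈ R}
        = ∑ x, ∑ π, prob (P π) (E π x) := by
    rw [sum_comm]
    exact sum_congr rfl fun π _ => prob_eq_sum_fiber _ _ Prod.fst
  rw [hE, hE, show (Fintype.card (Equiv.Perm X) : ℝ) = n from rfl]
  have := mul_le_mul_of_nonneg_left (sum_le_sum fun x (_ : x ∈ univ) => hfix x)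
    (inv_nonneg.2 hn.le)
  rw [← mul_sum, ← mul_sum] at this
  calc _ = _ := by ring
    _ ≤ _ := this
    _ = _ := by ring
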